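/- Let $m\ge 1$. For $n\ge1$ let $\mathcal F^n$ be the class of all $F\in C^{n-1}(\mathbb R)$ such that $F^{(n-1)}$ is Lipschitz continuous; then $F^{(n)}$ exists Lebesgue-almost everywhere. For a finite set of real points $x_1<\dots<x_k$ ($k\ge0$), an integer $n\ge k$, $n\ge 1$, and $F\in\mathcal F^n$, let $L_F(t)=\sum_{l=1}^k F(x_l)\prod_{r\ne l}\frac{t-x_r}{x_l-x_r}$ be the interpolation polynomial of $F$ at the nodes (so $L_F=0$ if $k=0$), let $$R_F(t)=\sum_{i=0}^{n-1}\frac{F^{(i)}(0)}{i!}t^i\ \text{ if } k=0,\qquad R_F(t)=\prod_{l=1}^k(t-x_l)\sum_{i=0}^{n-k-1}\Bigl(\sum_{j=i}^{n-k-1}\frac{F^{(k+j)}(0)\,a_i^{(j)}}{(k+j)!}\Bigr)t^i\ \text{ if } k\ge1,$$ where $a_i^{(j)}=\sum_{l=1}^k x_l^{k+j-i-1}\big/\prod_{r\neq l}(x_l-x_r)$, and put $Q_F=L_F+R_F$. Let $B_0,\dots,B_{m-1}:\mathbb R\to\mathbb R$ be Borel measurable. Suppose that for each $j$ there are an integer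 $0\le k_j\le m-j$ with $k_j\equiv m-j \pmod 2$ and points $x_{j,1}<\dots<x_{j,k_j}$ such that $B_j$ has sign changes at these points and is nonnegative on the last interval, in the following sense: with $J_1=(-\infty,x_{j,1}]$, $J_i=(x_{j,i-1},x_{j,i}]$ for $2\le i\le k_j$ and $J_{k_j+1}=(x_{j,k_j},\infty)$ one has $(-1)^{k_j+1-i}B_j\ge0$ on $J_i$ for all $1\le i\le k_j+1$ (if $k_j=0$: $B_j\ge0$ on $\mathbb R$). Write $Q_{j,F}$ for the polynomial $Q_F$ with nodes $x_{j,1},\dots,x_{j,k_j}$ and order $n=m-j$. Let $X$ be a real random variable with $E|B_j(X)X^l|<\infty$ for all $0\le j\le m-1$, $0\le l\le m-j$, and set $$\beta_j=\frac1{(m-j)!}E\Bigl[B_j(X)\Bigl(X^{m-j}-\sum_{l=1}^{k_j}x_{j,l}^{m-j}\prod_{r\ne l}\frac{X-x_{j,r}}{x_{j,l}-x_{j,r}}\Bigr)\Bigr],\qquad \beta=\sum_{j=0}^{m-1}\beta_j .$$ Assume that $\beta_j>0$ for at least one $j$. Then all $\beta_j$ are nonnegative, so $\beta>0$; for all $f\in\mathcal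 F^m$ and all $j$ the variable $B_j(X)\bigl(f^{(j)}(X)-Q_{j,f^{(j)}}(X)\bigr)$ is integrable; and there is a unique probability law for a random variable $X^*$ such that $$\sum_{j=0}^{m-1}E\Bigl[B_j(X)\bigl(f^{(j)}(X)-Q_{j,f^{(j)}}(X)\bigr)\Bigr]=\beta\,E\bigl[f^{(m)}(X^*)\bigr]\qquad\text{for all } f\in\mathcal F^m .$$ This law is absolutely continuous with respect to Lebesgue measure, and it is the only probability law on $\mathbb R$ for which the identity holds for all $f\in\mathcal F^m\cap C^m(\mathbb R)$. Moreover, it is a mixture $$\mathcal L(X^*)=\sum_{j=0}^{m-1}\frac{\beta_j}{\beta}\,\nu_j$$ of probability laws $\nu_j$, where for each $j$ with $\beta_j>0$ the law $\nu_j$ is the $X$-$(B_j,m-j)$ biased distribution, i.e. $E\bigl[B_j(X)\bigl(F(X)-Q_{j,F}(X)\bigr)\bigr]=\beta_j\int F^{(m-j)}\,d\nu_j$ for all $F\in\mathcal F^{m-j}$. -/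

import Mathlib

open MeasureTheory

noncomputable section

namespace DistTransform

/-- The class `𝓕ⁿ` of test functions: bounded Borel functions for `n = 0`; for `n ≥ 1`, the functions
in `C^{n-1}(ℝ)` whose derivative of order `n - 1` is Lipschitz. -/
def TestClass : ℕ → Set (ℝ → ℝ)
  | 0 => {F | Measurable F ∧ ∃ C : ℝ, ∀ t, |F t| ≤ C}
  | n + 1 => {F | ContDiff ℝ n F ∧ ∃ K : NNReal, LipschitzWith K (iteratedDeriv n F)}

/-- `B` has `k` sign changes, at `x₁ < ⋯ < x_k`, and its sign on the last interval is nonnegative.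
With `J₁ = (-∞, x₁]`, `J_i = (x_{i-1}, x_i]`, `J_{k+1} = (x_k, ∞)`, this means that
`(-1)^{k+1-i} B(t) ≥ 0` for `t ∈ J_i`; the number of nodes `≥ t` is `k + 1 - i` exactly when
`t ∈ J_i`. For `k = 0` it says that `B ≥ 0`. -/
def HasSignChanges {k : ℕ} (B : ℝ → ℝ) (x : Fin k → ℝ) : Prop :=
  StrictMono x ∧
    ∀ t : ℝ, 0 ≤ (-1 : ℝ) ^ (Finset.univ.filter (fun i : Fin k => t ≤ x i)).card * B t

/-- The interpolation polynomial `L_F` of `F` at the nodes `x` (zero if there are no nodes). -/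
def interpPoly {k : ℕ} (x : Fin k → ℝ) (F : ℝ → ℝ) : Polynomial ℝ :=
  Lagrange.interpolate Finset.univ x (fun l => F (x l))

/-- `a_i^{(j)} = ∑_l x_l^{k+j-i-1} / ∏_{r ≠ l} (x_l - x_r)`, used for `k ≥ 1` and `j ≥ i`. -/
def aCoeff {k : ℕ} (x : Fin k → ℝ) (i j : ℕ) : ℝ :=
  ∑ l : Fin k, x l ^ (k + j - i - 1) / ∏ r ∈ Finset.univ.erase l, (x l - x r)

/-- The polynomial `R_F` for the nodes `x` and the order `n`. -/
def remPoly {k : ℕ} (x : Fin k → ℝ) (n : ℕ) (F : ℝ → ℝ) : Polynomial ℝ :=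
  if k = 0 then
    ∑ j ∈ Finset.range n,
      Polynomial.C (iteratedDeriv j F 0 / (j.factorial : ℝ)) * Polynomial.X ^ j
  else
    Lagrange.nodal Finset.univ x *
      ∑ i ∈ Finset.range (n - k),
        Polynomial.C (∑ j ∈ Finset.Ico i (n - k),
          iteratedDeriv (k + j) F 0 * aCoeff x i j / ((k + j).factorial : ℝ)) *
        Polynomial.X ^ i

/-- `Q_F = L_F + R_F`, for the nodes `x` and the order `n`. -/
def qPoly {k : ℕ} (x : Fin k → ℝ) (n : ℕ) (F : ℝ → ℝ) : Polynomial ℝ :=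
  interpPoly x F + remPoly x n F

/-- `(1 / n!) E[B(X) (Xⁿ - ∑_l x_lⁿ ∏_{r ≠ l} (X - x_r) / (x_l - x_r))]`. -/
def biasConst {Ω : Type*} [MeasurableSpace Ω] (P : Measure Ω) (X : Ω → ℝ) (B : ℝ → ℝ)
    {k : ℕ} (x : Fin k → ℝ) (n : ℕ) : ℝ :=
  (1 / (n.factorial : ℝ)) *
    ∫ ω, B (X ω) * (X ω ^ n - (interpPoly x (fun t => t ^ n)).eval (X ω)) ∂P

/-- `ν` is the `X`-`(B, n)` biased distribution (with respect to the sign change points `x`). -/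
def IsBiasedLaw {Ω : Type*} [MeasurableSpace Ω] (P : Measure Ω) (X : Ω → ℝ) (B : ℝ → ℝ)
    {k : ℕ} (x : Fin k → ℝ) (n : ℕ) (ν : Measure ℝ) : Prop :=
  IsProbabilityMeasure ν ∧
    ∀ F ∈ TestClass n,
      ∫ ω, B (X ω) * (F (X ω) - (qPoly x n F).eval (X ω)) ∂P =
        biasConst P X B x n * ∫ y, iteratedDeriv n F y ∂ν

/-- `β = ∑_j β_j`, where `β_j` is the constant of `B_j` for the order `m - j`. -/
def totalConst {Ω : Type*} [MeasurableSpace Ω] (P : Measure Ω) (X : Ω → ℝ) {m : ℕ}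
    (B : Fin m → ℝ → ℝ) {k : Fin m → ℕ} (x : (j : Fin m) → Fin (k j) → ℝ) : ℝ :=
  ∑ j : Fin m, biasConst P X (B j) (x j) (m - (j : ℕ))

/-- The identity `∑_j E[B_j(X) (f^{(j)}(X) - Q_{j, f^{(j)}}(X))] = β ∫ f^{(m)} dν`. -/
def HigherOrderIdentity {Ω : Type*} [MeasurableSpace Ω] (P : Measure Ω) (X : Ω → ℝ) {m : ℕ}
    (B : Fin m → ℝ → ℝ) {k : Fin m → ℕ} (x : (j : Fin m) → Fin (k j) → ℝ)
    (ν : Measure ℝ) (f : ℝ → ℝ) : Prop :=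
  ∑ j : Fin m, ∫ ω, B j (X ω) * (iteratedDeriv (j : ℕ) f (X ω) -
      (qPoly (x j) (m - (j : ℕ)) (iteratedDeriv (j : ℕ) f)).eval (X ω)) ∂P =
    totalConst P X B x * ∫ y, iteratedDeriv m f y ∂ν

end DistTransform

end

noncomputable section

/-! The proof rests on a Peano kernel. Let `T` be the Taylor polynomial of `F` at `0` of degree
below the order `n`. Then `R_F = T - L_T` (`remPoly_eq`), so `F - Q_F` is the interpolation error of
the Taylor remainder `F - T`. The integral form of that remainder gives `F(t) - Q_F(t) = ∫ K(t,s)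
F^{(n)}(s) ds`, where `K(t,s)` is the interpolation error of a signed truncated power.

The sign of `K` is decisive. Off the nodes, `K(t,s)` is `∏ (t - x_l)` times a divided difference of
order `k ≤ n`, which is nonnegative by `divDiff_truncPow_nonneg` and the parity of `k`. The sign
changes of `B` match those of the product, so `B(t) K(t,s) ≥ 0`. By Fubini, `p(s) = E[B(X) K(X,s)]`
is a nonnegative density of total mass `β_j`, and `p / β_j` is the biased law
(`exists_isBiasedLaw`).

Applying this to each `f^{(j)}` and summing gives the mixture. Uniqueness holds because every
bounded continuous function is an `m`-th derivative of a test function. -/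

namespace DistTransform

/-! ### Divided differences of truncated powers. -/

/-- The divided difference of `g` at the points of `S`. -/
def divDiff (S : Finset ℝ) (g : ℝ → ℝ) : ℝ :=
  ∑ y ∈ S, g y / ∏ r ∈ S.erase y, (y - r)

lemma divDiff_congr {S : Finset ℝ} {g h : ℝ → ℝ} (H : ∀ y ∈ S, g y = h y) :
    divDiff S g = divDiff S h :=
  Finset.sum_congr rfl fun y hy => by rw [H y hy]

lemma divDiff_add (S : Finset ℝ) (g h : ℝ → ℝ) :
    divDiff S (fun t => g t + h t) = divDiff S g + divDiff S h := by
  simp only [divDiff, add_div, Finset.sum_add_distrib]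

lemma divDiff_const_mul (S : Finset ℝ) (c : ℝ) (g : ℝ → ℝ) :
    divDiff S (fun t => c * g t) = c * divDiff S g := by
  simp only [divDiff, mul_div_assoc, Finset.mul_sum]

lemma divDiff_singleton (y : ℝ) (g : ℝ → ℝ) : divDiff {y} g = g y := by
  simp [divDiff]

lemma divDiff_pair {a b : ℝ} (h : a ≠ b) (g : ℝ → ℝ) :
    divDiff {a, b} g = (g b - g a) / (b - a) := by
  have h1 : ({a, b} : Finset ℝ).erase a = {b} := by
    ext z; simp only [Finset.mem_erase, Finset.mem_insert, Finset.mem_singleton]; grind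
  have h2 : ({a, b} : Finset ℝ).erase b = {a} := by
    ext z; simp only [Finset.mem_erase, Finset.mem_insert, Finset.mem_singleton]; grind
  rw [divDiff, Finset.sum_pair h, h1, h2, Finset.prod_singleton, Finset.prod_singleton]
  have : b - a ≠ 0 := sub_ne_zero.2 h.symm
  have : a - b ≠ 0 := sub_ne_zero.2 h
  field_simp
  ring

/-- The factor `t - z` kills the term at `z` and cancels against the factor `y - z` in every other
denominator. -/
lemma divDiff_sub_mul {S : Finset ℝ} {z : ℝ} (hz : z ∈ S) (g : ℝ → ℝ) :
    divDiff S (fun t => (t - z) * g t) = divDiff (S.erase z) g := by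
  unfold divDiff
  rw [← Finset.sum_erase S (a := z) (by simp)]
  refine Finset.sum_congr rfl fun y hy => ?_
  have hne : z ≠ y := (Finset.ne_of_mem_erase hy).symm
  rw [← Finset.mul_prod_erase (S.erase y) _ (Finset.mem_erase.2 ⟨hne, hz⟩),
    Finset.erase_right_comm, mul_div_mul_left _ _ (sub_ne_zero.2 hne.symm)]

lemma divDiff_sub_mul_shift {S : Finset ℝ} {z : ℝ} (hz : z ∈ S) (c : ℝ) (g : ℝ → ℝ) :
    divDiff S (fun t => (t - c) * g t) = divDiff (S.erase z) g + (z - c) * divDiff S g := by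
  rw [← divDiff_sub_mul hz, ← divDiff_const_mul, ← divDiff_add]
  exact divDiff_congr fun y _ => by ring

/-- This comes from `(b - a)(t - c) = (b - c)(t - a) + (c - a)(t - b)`. For `a ≤ c ≤ b` both weights
are nonnegative, so positivity passes from degree `n` to `n + 1`. -/
lemma divDiff_sub_mul_convex {S : Finset ℝ} {a b : ℝ} (ha : a ∈ S) (hb : b ∈ S) (c : ℝ)
    (g : ℝ → ℝ) :
    (b - a) * divDiff S (fun t => (t - c) * g t) =
      (b - c) * divDiff (S.erase a) g + (c - a) * divDiff (S.erase b) g := by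
  rw [← divDiff_sub_mul ha, ← divDiff_sub_mul hb, ← divDiff_const_mul, ← divDiff_const_mul,
    ← divDiff_const_mul, ← divDiff_add]
  exact divDiff_congr fun y _ => by ring

lemma divDiff_image_neg (S : Finset ℝ) (g : ℝ → ℝ) :
    divDiff (S.image Neg.neg) g = (-1) ^ (S.card - 1) * divDiff S (fun t => g (-t)) := by
  unfold divDiff
  rw [Finset.sum_image (fun _ _ _ _ h => neg_injective h), Finset.mul_sum]
  refine Finset.sum_congr rfl fun y hy => ?_
  rw [← Finset.image_erase neg_injective, Finset.prod_image (fun _ _ _ _ h => neg_injective h)]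
  have : ∏ r ∈ S.erase y, (-y - -r) = (-1) ^ (S.card - 1) * ∏ r ∈ S.erase y, (y - r) := by
    rw [← Finset.card_erase_of_mem hy, ← Finset.prod_const, ← Finset.prod_mul_distrib]
    exact Finset.prod_congr rfl fun r _ => by ring
  rw [this]
  rcases neg_one_pow_eq_or ℝ (S.card - 1) with h | h <;> simp [h, div_neg]

lemma divDiff_pow_eq_zero (n : ℕ) (c : ℝ) :
    ∀ S : Finset ℝ, S.card = n + 2 → divDiff S (fun t => (t - c) ^ n) = 0 := by
  induction n with
  | zero =>
    intro S hS
    obtain ⟨a, b, hab, rfl⟩ := Finset.card_eq_two.1 hS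
    simp [divDiff_pair hab]
  | succ n ih =>
    intro S hS
    obtain ⟨a, ha, b, hb, hab⟩ := Finset.one_lt_card.1 (by omega : 1 < S.card)
    have h := divDiff_sub_mul_convex ha hb c (fun t => (t - c) ^ n)
    rw [ih _ (by rw [Finset.card_erase_of_mem ha]; omega),
      ih _ (by rw [Finset.card_erase_of_mem hb]; omega)] at h
    simp only [← pow_succ'] at h
    simpa [sub_eq_zero, hab.symm] using h

/-- Divided differences of order at most `n + 1` of the truncated power of degree `n` are
nonnegative; the step function `h` may take any value in `[0, 1]` at the jump. -/
lemma divDiff_truncPow_nonneg {c : ℝ} {h : ℝ → ℝ} (h0 : ∀ t < c, h t = 0)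
    (h1 : ∀ t, c < t → h t = 1) (hc : 0 ≤ h c ∧ h c ≤ 1) (n : ℕ) :
    ∀ (k : ℕ) (S : Finset ℝ), S.card = k + 1 → k ≤ n + 1 →
      0 ≤ divDiff S (fun t => (t - c) ^ n * h t) := by
  have hsingle : ∀ n : ℕ, ∀ y, 0 ≤ (y - c) ^ n * h y := by
    intro n y
    rcases lt_trichotomy y c with hy | hy | hy
    · simp [h0 y hy]
    · rw [hy, sub_self]; exact mul_nonneg (by positivity) hc.1
    · rw [h1 y hy, mul_one]; exact pow_nonneg (by linarith) _
  induction n with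
  | zero =>
    intro k S hS hk
    obtain rfl | rfl : k = 0 ∨ k = 1 := by omega
    · obtain ⟨y, rfl⟩ := Finset.card_eq_one.1 hS
      rw [divDiff_singleton]; exact hsingle 0 y
    · obtain ⟨a, b, hab, rfl⟩ := Finset.card_eq_two.1 hS
      have hmono : Monotone h := by
        intro u v huv
        rcases lt_trichotomy u c with hu | hu | hu <;>
        rcases lt_trichotomy v c with hv | hv | hv <;> grind
      simp only [divDiff_pair hab, pow_zero, one_mul]
      rcases lt_or_gt_of_ne hab with hlt | hlt
      · exact div_nonneg (sub_nonneg.2 (hmono hlt.le)) (by linarith)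
      · exact div_nonneg_of_nonpos (sub_nonpos.2 (hmono hlt.le)) (by linarith)
  | succ n ih =>
    intro k S hS hk
    rcases Nat.eq_zero_or_pos k with rfl | hk0
    · obtain ⟨y, rfl⟩ := Finset.card_eq_one.1 hS
      rw [divDiff_singleton]; exact hsingle _ y
    have hne : S.Nonempty := Finset.card_pos.1 (by omega)
    set a := S.min' hne with ha'
    set b := S.max' hne with hb'
    have ha : a ∈ S := S.min'_mem hne
    have hb : b ∈ S := S.max'_mem hne
    have hab : a < b := Finset.min'_lt_max'_of_card S (by omega)
    have hpow : ∀ t, (t - c) ^ (n + 1) * h t = (t - c) * ((t - c) ^ n * h t) := fun t => by ring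
    rcases lt_or_ge b c with hbc | hbc
    -- All points lie left of the knot, where the truncated power vanishes.
    · rw [divDiff_congr (h := fun t => 0 * 0)
        (fun y hy => by rw [h0 y (lt_of_le_of_lt (S.le_max' y hy) hbc)]; simp), divDiff_const_mul]
      simp
    rcases lt_or_ge c a with hca | hca
    -- All points lie right of the knot, where the function is a polynomial of degree `n + 1`. Order
    -- `n + 2` annihilates it; lower orders follow from the Leibniz rule with `a - c > 0`.
    · rcases Nat.lt_or_ge (n + 1) k with hkn | hkn
      · rw [divDiff_congr (h := fun t => (t - c) ^ (n + 1))
          (fun y hy => by rw [h1 y (lt_of_lt_of_le hca (S.min'_le y hy)), mul_one]),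
          divDiff_pow_eq_zero _ _ _ (by omega)]
      · simp only [hpow]
        rw [divDiff_sub_mul_shift ha]
        refine add_nonneg (ih (k - 1) _ (by rw [Finset.card_erase_of_mem ha]; omega) (by omega))
          (mul_nonneg (by linarith) (ih k S hS hkn))
    -- The knot lies between the extreme points: use the convex combination of the two differences
    -- of order `k - 1`.
    · simp only [hpow]
      have key := divDiff_sub_mul_convex ha hb c (fun t => (t - c) ^ n * h t)
      have e1 := ih (k - 1) (S.erase a) (by rw [Finset.card_erase_of_mem ha]; omega) (by omega)
      have e2 := ih (k - 1) (S.erase b) (by rw [Finset.card_erase_of_mem hb]; omega) (by omega)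
      refine nonneg_of_mul_nonneg_right ?_ (sub_pos.2 hab)
      rw [key]
      exact add_nonneg (mul_nonneg (by linarith) e1) (mul_nonneg (by linarith) e2)

/-- The kernel of the integral remainder in Taylor's formula of degree `n` at `0`. -/
def taylorKernel (n : ℕ) (t s : ℝ) : ℝ :=
  (if 0 < s then (if s ≤ t then 1 else 0) else (if t < s then -1 else 0)) *
    ((t - s) ^ n / (n.factorial : ℝ))

/-- For `s ≤ 0` the kernel is a truncated power in `-t` with sign `(-1)^(n+1)`. Reflecting the `k +
1` points costs `(-1)^k`, and the parity assumption makes the two signs cancel. -/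
lemma divDiff_taylorKernel_nonneg (n k : ℕ) (hk : k ≤ n + 1) (hpar : k ≡ n + 1 [MOD 2])
    (S : Finset ℝ) (hS : S.card = k + 1) (s : ℝ) :
    0 ≤ divDiff S (fun t => taylorKernel n t s) := by
  have hf : (0 : ℝ) ≤ 1 / (n.factorial : ℝ) := by positivity
  by_cases hs : 0 < s
  · have := divDiff_truncPow_nonneg (c := s) (h := fun t => if s ≤ t then 1 else 0)
      (fun t ht => by simp [ht]) (fun t ht => by simp [ht.le]) (by simp) n k S hS hk
    rw [divDiff_congr (h := fun t => 1 / (n.factorial : ℝ) *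
      ((t - s) ^ n * if s ≤ t then 1 else 0)) (fun y _ => by rw [taylorKernel, if_pos hs]; ring),
      divDiff_const_mul]
    exact mul_nonneg hf this
  · have := divDiff_truncPow_nonneg (c := -s) (h := fun t => if -s < t then 1 else 0)
      (fun t ht => by simp [ht.le]) (fun t ht => by simp [ht]) (by simp) n k
      (S.image Neg.neg) (by rw [Finset.card_image_of_injective _ neg_injective, hS]) hk
    rw [divDiff_image_neg, hS, Nat.add_sub_cancel] at this
    rw [divDiff_congr (h := fun t => 1 / (n.factorial : ℝ) * ((-1) ^ (n + 1) *
      ((-t - -s) ^ n * if -s < -t then 1 else 0))) (fun y _ => by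
        rw [taylorKernel, if_neg hs]
        have : (-y - -s) ^ n = (-1) ^ n * (y - s) ^ n := by rw [← mul_pow]; congr 1; ring
        have e : ((-1 : ℝ) ^ (n + 1)) * (-1) ^ n = -1 := by
          rw [← pow_add, show n + 1 + n = 2 * n + 1 by ring, pow_succ, pow_mul]; simp
        simp only [neg_lt_neg_iff]
        split_ifs
        · rw [this]; linear_combination (-(1 / (n.factorial : ℝ) * (y - s) ^ n)) * e
        · simp),
      divDiff_const_mul, divDiff_const_mul]
    have e : (-1 : ℝ) ^ (n + 1) = (-1) ^ k := by
      rw [neg_one_pow_eq_pow_mod_two, neg_one_pow_eq_pow_mod_two (n := k)]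
      rw [hpar]
    rw [e]
    exact mul_nonneg hf this

/-! ### The Peano kernel and its sign. -/

/-- The error at `t` of the interpolation of `u ↦ taylorKernel n u s` at the nodes `x`. -/
def peanoKernel {k : ℕ} (x : Fin k → ℝ) (n : ℕ) (t s : ℝ) : ℝ :=
  taylorKernel n t s - (interpPoly x (fun u => taylorKernel n u s)).eval t

lemma sub_eval_interpPoly {k : ℕ} {x : Fin k → ℝ} (hx : Function.Injective x) (g : ℝ → ℝ) (t : ℝ)
    (ht : ∀ i, t ≠ x i) :
    g t - (interpPoly x g).eval t =
      (Lagrange.nodal Finset.univ x).eval t * divDiff (insert t (Finset.univ.image x)) g := by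
  have hmem : t ∉ Finset.univ.image x := by simpa using fun i => (ht i).symm
  have h0 : (Lagrange.nodal Finset.univ x).eval t ≠ 0 :=
    Lagrange.eval_nodal_not_at_node fun i _ => ht i
  rw [interpPoly, Lagrange.eval_interpolate_not_at_node _ fun i _ => ht i, divDiff,
    Finset.sum_insert hmem, Finset.erase_insert hmem, Finset.prod_image (fun _ _ _ _ h => hx h),
    ← Lagrange.eval_nodal, mul_add, mul_div_cancel₀ _ h0, sub_eq_add_neg, ← mul_neg,
    Finset.sum_image (fun _ _ _ _ h => hx h), ← Finset.sum_neg_distrib]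
  congr 2
  refine Finset.sum_congr rfl fun i _ => ?_
  rw [Finset.erase_insert_of_ne (ht i), Finset.prod_insert (by simpa using fun _ j => (ht j).symm),
    ← Finset.image_erase hx, Finset.prod_image (fun _ _ _ _ h => hx h), Lagrange.nodalWeight,
    Finset.prod_inv_distrib, ← neg_sub t (x i), neg_mul, div_neg, div_eq_mul_inv, mul_inv]
  ring

/-- The factors `t - x i` that are not positive are those with `t ≤ x i`, which are exactly the ones
counted in `HasSignChanges`. -/
lemma mul_eval_nodal_nonneg {k : ℕ} {B : ℝ → ℝ} {x : Fin k → ℝ} (h : HasSignChanges B x) (t : ℝ) :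
    0 ≤ B t * (Lagrange.nodal Finset.univ x).eval t := by
  have h1 : 0 ≤ (-1 : ℝ) ^ (Finset.univ.filter (fun i : Fin k => t ≤ x i)).card *
      (Lagrange.nodal Finset.univ x).eval t := by
    rw [← Finset.prod_const, Finset.prod_filter, Lagrange.eval_nodal, ← Finset.prod_mul_distrib]
    refine Finset.prod_nonneg fun i _ => ?_
    split_ifs <;> linarith
  have h2 := mul_nonneg (h.2 t) h1
  rcases neg_one_pow_eq_or ℝ (Finset.univ.filter (fun i : Fin k => t ≤ x i)).card with e | e <;>
    simpa [e] using h2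

lemma mul_peanoKernel_nonneg {k n : ℕ} {B : ℝ → ℝ} {x : Fin k → ℝ} (h : HasSignChanges B x)
    (hk : k ≤ n + 1) (hpar : k ≡ n + 1 [MOD 2]) (t s : ℝ) : 0 ≤ B t * peanoKernel x n t s := by
  have hx := h.1.injective
  by_cases ht : ∃ i, t = x i
  · obtain ⟨i, rfl⟩ := ht
    rw [peanoKernel, interpPoly,
      Lagrange.eval_interpolate_at_node _ hx.injOn (Finset.mem_univ i)]
    simp
  · push Not at ht
    rw [peanoKernel, sub_eval_interpPoly hx (fun u => taylorKernel n u s) t ht, ← mul_assoc]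
    refine mul_nonneg (mul_eval_nodal_nonneg h t)
      (divDiff_taylorKernel_nonneg n k hk hpar _ ?_ s)
    rw [Finset.card_insert_of_notMem (by simpa using fun i => (ht i).symm),
      Finset.card_image_of_injective _ hx, Finset.card_fin]

/-! ### The correction term as `T - L_T`. -/

open Polynomial in
lemma X_sub_C_mul_basis {k : ℕ} (x : Fin k → ℝ) (i : Fin k) :
    (X - C (x i)) * Lagrange.basis Finset.univ x i =
      C (Lagrange.nodalWeight Finset.univ x i) * Lagrange.nodal Finset.univ x := by
  rw [Lagrange.nodal_eq_mul_nodal_erase (Finset.mem_univ i), Lagrange.basis, Lagrange.nodalWeight,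
    map_prod, Lagrange.nodal_eq]
  simp only [Lagrange.basisDivisor, Finset.prod_mul_distrib]
  ring

-- Both `X * interpPoly x (t ^ p)` and the next interpolant agree at the nodes. They differ by a
-- multiple of the nodal polynomial, whose factor is a divided difference of a power.
open Polynomial in
lemma X_mul_interpPoly_pow {k : ℕ} (x : Fin k → ℝ) (p : ℕ) :
    X * interpPoly x (fun t => t ^ p) = interpPoly x (fun t => t ^ (p + 1)) +
      C (∑ l : Fin k, x l ^ p / ∏ r ∈ Finset.univ.erase l, (x l - x r)) *
        Lagrange.nodal Finset.univ x := by
  simp only [interpPoly, Lagrange.interpolate_apply, Finset.mul_sum, map_sum, Finset.sum_mul,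
    ← Finset.sum_add_distrib]
  refine Finset.sum_congr rfl fun i _ => ?_
  have h := X_sub_C_mul_basis x i
  rw [Lagrange.nodalWeight, Finset.prod_inv_distrib] at h
  rw [div_eq_mul_inv, C_mul, mul_assoc, ← h, pow_succ, C_mul]
  ring

lemma interpPoly_eval_eq_self {k : ℕ} {x : Fin k → ℝ} (hx : Function.Injective x)
    {p : Polynomial ℝ} (hp : p.degree < k) : interpPoly x (fun t => p.eval t) = p :=
  (Lagrange.eq_interpolate hx.injOn (by simpa using hp)).symm

open Polynomial in
lemma X_pow_eq_interpPoly_of_lt {k : ℕ} {x : Fin k → ℝ} (hx : Function.Injective x) {p : ℕ}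
    (hp : p < k) : (X : ℝ[X]) ^ p = interpPoly x (fun t => t ^ p) := by
  have := interpPoly_eval_eq_self hx (p := X ^ p) (by rw [degree_X_pow]; exact_mod_cast hp)
  simpa using this.symm

-- The `aCoeff x i j` are the coefficients of the quotient of `X ^ (k + j)` by the nodal polynomial.
-- Multiplying by `X` shifts them, `aCoeff x (i+1) (j+1) = aCoeff x i j`, and adds one new constant
-- term.
open Polynomial in
lemma X_pow_eq_interpPoly_add {k : ℕ} {x : Fin k → ℝ} (hx : Function.Injective x) (hk : k ≠ 0)
    (j : ℕ) :
    (X : ℝ[X]) ^ (k + j) = interpPoly x (fun t => t ^ (k + j)) +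
      Lagrange.nodal Finset.univ x * ∑ i ∈ Finset.range (j + 1), C (aCoeff x i j) * X ^ i := by
  induction j with
  | zero =>
    obtain ⟨q, rfl⟩ := Nat.exists_eq_succ_of_ne_zero hk
    have h := X_mul_interpPoly_pow x q
    rw [← X_pow_eq_interpPoly_of_lt hx q.lt_succ_self, ← pow_succ'] at h
    simp only [Nat.succ_eq_add_one, add_zero, zero_add, Finset.sum_range_one, pow_zero, mul_one,
      aCoeff, Nat.sub_zero, Nat.add_sub_cancel]
    rw [h, mul_comm (Lagrange.nodal _ _)]
  | succ j ih =>
    have h := X_mul_interpPoly_pow x (k + j)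
    have hs : ∑ i ∈ Finset.range (j + 1 + 1), C (aCoeff x i (j + 1)) * (X : ℝ[X]) ^ i =
        X * ∑ i ∈ Finset.range (j + 1), C (aCoeff x i j) * X ^ i +
          C (∑ l : Fin k, x l ^ (k + j) / ∏ r ∈ Finset.univ.erase l, (x l - x r)) := by
      rw [Finset.sum_range_succ', Finset.mul_sum]
      congr 1
      · refine Finset.sum_congr rfl fun i _ => ?_
        have : k + (j + 1) - (i + 1) - 1 = k + j - i - 1 := by omega
        simp only [aCoeff, this]
        ring
      · have : k + (j + 1) - 0 - 1 = k + j := by omega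
        simp only [aCoeff, this, pow_zero, mul_one]
    rw [hs, ← add_assoc]
    linear_combination X * ih + h

/-- The Taylor polynomial of `F` at `0` of degree less than `n`. -/
def taylorPoly (n : ℕ) (F : ℝ → ℝ) : Polynomial ℝ :=
  ∑ j ∈ Finset.range n,
    Polynomial.C (iteratedDeriv j F 0 / (j.factorial : ℝ)) * Polynomial.X ^ j

lemma interpPoly_sub {k : ℕ} (x : Fin k → ℝ) (F G : ℝ → ℝ) :
    interpPoly x (fun t => F t - G t) = interpPoly x F - interpPoly x G :=
  map_sub (Lagrange.interpolate Finset.univ x) (fun l => F (x l)) (fun l => G (x l))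

lemma interpPoly_const_mul {k : ℕ} (x : Fin k → ℝ) (c : ℝ) (F : ℝ → ℝ) :
    interpPoly x (fun t => c * F t) = Polynomial.C c * interpPoly x F := by
  rw [← Polynomial.smul_eq_C_mul]
  exact map_smul (Lagrange.interpolate Finset.univ x) c (fun l => F (x l))

lemma interpPoly_sum {k : ℕ} (x : Fin k → ℝ) {ι : Type*} (s : Finset ι) (F : ι → ℝ → ℝ) :
    interpPoly x (fun t => ∑ i ∈ s, F i t) = ∑ i ∈ s, interpPoly x (F i) := by
  rw [interpPoly, show (fun l => ∑ i ∈ s, F i (x l)) = ∑ i ∈ s, fun l => F i (x l) by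
    ext l; simp, map_sum]
  rfl

-- Powers below `k` equal their interpolants and drop out. The others contribute their quotients by
-- the nodal polynomial, and exchanging the two sums gives the explicit formula.
open Polynomial in
lemma remPoly_eq {k : ℕ} {x : Fin k → ℝ} (hx : Function.Injective x) {n : ℕ} (hkn : k ≤ n)
    (F : ℝ → ℝ) :
    remPoly x n F = taylorPoly n F - interpPoly x (fun t => (taylorPoly n F).eval t) := by
  by_cases hk : k = 0
  · subst hk
    simp [remPoly, taylorPoly, interpPoly]
  have e : ∀ t, (taylorPoly n F).eval t =
      ∑ j ∈ Finset.range n, iteratedDeriv j F 0 / (j.factorial : ℝ) * t ^ j := by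
    intro t; simp [taylorPoly, eval_finsetSum]
  simp only [e, interpPoly_sum, interpPoly_const_mul]
  rw [remPoly, if_neg hk, taylorPoly, ← Finset.sum_sub_distrib]
  simp only [← mul_sub]
  have hz : ∑ p ∈ Finset.range k, C (iteratedDeriv p F 0 / (p.factorial : ℝ)) *
      ((X : ℝ[X]) ^ p - interpPoly x (fun t => t ^ p)) = 0 := Finset.sum_eq_zero fun p hp => by
    rw [← X_pow_eq_interpPoly_of_lt hx (Finset.mem_range.1 hp), sub_self, mul_zero]
  rw [← Finset.sum_range_add_sum_Ico _ hkn, hz, zero_add, Finset.sum_Ico_eq_sum_range,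
    Finset.mul_sum]
  have e2 : ∀ j, (X : ℝ[X]) ^ (k + j) - interpPoly x (fun t => t ^ (k + j)) =
      Lagrange.nodal Finset.univ x * ∑ i ∈ Finset.range (j + 1), C (aCoeff x i j) * X ^ i :=
    fun j => by rw [sub_eq_iff_eq_add', ← X_pow_eq_interpPoly_add hx hk]
  simp only [e2, map_sum, Finset.mul_sum, Finset.sum_mul]
  rw [Finset.sum_sigma', Finset.sum_sigma']
  refine Finset.sum_bij' (fun a _ => ⟨a.2, a.1⟩) (fun a _ => ⟨a.2, a.1⟩) ?_ ?_ ?_ ?_ ?_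
  · rintro ⟨i, j⟩ h
    simp only [Finset.mem_sigma, Finset.mem_range, Finset.mem_Ico] at h ⊢
    omega
  · rintro ⟨i, j⟩ h
    simp only [Finset.mem_sigma, Finset.mem_range, Finset.mem_Ico] at h ⊢
    omega
  · intros; rfl
  · intros; rfl
  · rintro ⟨i, j⟩ _
    simp only [mul_div_right_comm, C_mul]
    ring

lemma sub_eval_qPoly {k : ℕ} {x : Fin k → ℝ} (hx : Function.Injective x) {n : ℕ} (hkn : k ≤ n)
    (F : ℝ → ℝ) (t : ℝ) :
    F t - (qPoly x n F).eval t = (F t - (taylorPoly n F).eval t) -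
      (interpPoly x (fun u => F u - (taylorPoly n F).eval u)).eval t := by
  rw [qPoly, remPoly_eq hx hkn, interpPoly_sub, Polynomial.eval_add, Polynomial.eval_sub,
    Polynomial.eval_sub]
  ring

/-! ### Taylor's formula and the Peano representation. -/

/-- Absolute continuity is what allows integration by parts up to the top derivative, which exists
only almost everywhere. -/
lemma absolutelyContinuousOnInterval_iteratedDeriv {n : ℕ} {F : ℝ → ℝ} (hF : F ∈ TestClass (n + 1))
    {i : ℕ} (hi : i ≤ n) (a b : ℝ) : AbsolutelyContinuousOnInterval (iteratedDeriv i F) a b := by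
  obtain ⟨hF, K, hK⟩ := hF
  rcases hi.eq_or_lt with rfl | hi
  · exact (hK.lipschitzOnWith).absolutelyContinuousOnInterval
  · have h : ContDiff ℝ 1 (iteratedDeriv i F) := by
      rw [iteratedDeriv_eq_iterate]
      exact ContDiff.iterate_deriv' 1 i (hF.of_le (by norm_cast; omega))
    exact h.contDiffOn.absolutelyContinuousOnInterval

/-- Taylor's formula with the integral form of the remainder. -/
lemma sub_eval_taylorPoly {n : ℕ} {F : ℝ → ℝ} (hF : F ∈ TestClass (n + 1)) (t : ℝ) :
    ∀ i ≤ n, F t - (taylorPoly (i + 1) F).eval t =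
      ∫ s in (0 : ℝ)..t, ((t - s) ^ i / (i.factorial : ℝ)) * iteratedDeriv (i + 1) F s := by
  intro i
  induction i with
  | zero =>
    intro _
    have h := (absolutelyContinuousOnInterval_iteratedDeriv hF (Nat.zero_le n)
      0 t).integral_deriv_eq_sub
    simp only [iteratedDeriv_zero] at h
    simp [taylorPoly, iteratedDeriv_one, h]
  | succ i ih =>
    intro hi
    have hpoly : AbsolutelyContinuousOnInterval
        (fun s : ℝ => (t - s) ^ (i + 1) / ((i + 1).factorial : ℝ)) 0 t :=
      ContDiffOn.absolutelyContinuousOnInterval (by fun_prop)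
    have h := AbsolutelyContinuousOnInterval.integral_mul_deriv_eq_deriv_mul hpoly
      (absolutelyContinuousOnInterval_iteratedDeriv hF hi 0 t)
    rw [← iteratedDeriv_succ] at h
    rw [h]
    have hd : ∀ s, deriv (fun s : ℝ => (t - s) ^ (i + 1) / ((i + 1).factorial : ℝ)) s =
        - ((t - s) ^ i / (i.factorial : ℝ)) := by
      intro s
      have h1 : HasDerivAt (fun s : ℝ => (t - s) ^ (i + 1) / ((i + 1).factorial : ℝ))
          (((i + 1 : ℕ) : ℝ) * (t - s) ^ i * (-1) / ((i + 1).factorial : ℝ)) s := by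
        simpa using ((((hasDerivAt_id s).const_sub t).pow (i + 1)).div_const
          ((i + 1).factorial : ℝ))
      rw [h1.deriv, Nat.factorial_succ]
      push_cast
      have : (i : ℝ) + 1 ≠ 0 := by positivity
      field_simp
    simp only [hd, neg_mul, intervalIntegral.integral_neg]
    rw [← ih (by omega), taylorPoly, Finset.sum_range_succ, ← taylorPoly]
    simp
    ring

lemma taylorKernel_eq_indicator (n : ℕ) (t s : ℝ) :
    taylorKernel n t s = (Set.Ioc 0 t).indicator (fun s => (t - s) ^ n / (n.factorial : ℝ)) s -
      (Set.Ioc t 0).indicator (fun s => (t - s) ^ n / (n.factorial : ℝ)) s := by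
  simp only [taylorKernel, Set.indicator, Set.mem_Ioc]
  split_ifs <;> grind

lemma taylorKernel_mul_eq_indicator (n : ℕ) (t : ℝ) (g : ℝ → ℝ) :
    (fun s => taylorKernel n t s * g s) =
      fun s => (Set.Ioc 0 t).indicator (fun s => (t - s) ^ n / (n.factorial : ℝ) * g s) s -
        (Set.Ioc t 0).indicator (fun s => (t - s) ^ n / (n.factorial : ℝ) * g s) s := by
  ext s
  rw [taylorKernel_eq_indicator, Set.indicator_mul_left, Set.indicator_mul_left]
  simp only [Set.indicator]
  ring

lemma measurable_taylorKernel (n : ℕ) : Measurable (fun p : ℝ × ℝ => taylorKernel n p.1 p.2) := by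
  unfold taylorKernel
  refine Measurable.mul ?_ (by fun_prop)
  refine Measurable.ite (measurableSet_lt measurable_const measurable_snd) ?_ ?_
  · exact Measurable.ite (measurableSet_le measurable_snd measurable_fst) measurable_const
      measurable_const
  · exact Measurable.ite (measurableSet_lt measurable_fst measurable_snd) measurable_const
      measurable_const

lemma integrable_taylorKernel_mul (n : ℕ) (t : ℝ) {g : ℝ → ℝ}
    (hg : ∀ a b, IntervalIntegrable g volume a b) :
    Integrable (fun s => taylorKernel n t s * g s) := by
  have h : ∀ a b : ℝ, IntervalIntegrable (fun s => (t - s) ^ n / (n.factorial : ℝ) * g s)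
      volume a b := fun a b => (hg a b).continuousOn_mul (by fun_prop)
  rw [taylorKernel_mul_eq_indicator]
  exact ((h 0 t).1.integrable_indicator measurableSet_Ioc).sub
    ((h t 0).1.integrable_indicator measurableSet_Ioc)

lemma integral_taylorKernel_mul (n : ℕ) (t : ℝ) {g : ℝ → ℝ}
    (hg : ∀ a b, IntervalIntegrable g volume a b) :
    ∫ s, taylorKernel n t s * g s =
      ∫ s in (0 : ℝ)..t, ((t - s) ^ n / (n.factorial : ℝ)) * g s := by
  have h : ∀ a b : ℝ, IntervalIntegrable (fun s => (t - s) ^ n / (n.factorial : ℝ) * g s)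
      volume a b := fun a b => (hg a b).continuousOn_mul (by fun_prop)
  rw [taylorKernel_mul_eq_indicator, integral_sub
    ((h 0 t).1.integrable_indicator measurableSet_Ioc)
    ((h t 0).1.integrable_indicator measurableSet_Ioc),
    integral_indicator measurableSet_Ioc, integral_indicator measurableSet_Ioc, intervalIntegral]

lemma measurable_peanoKernel {k : ℕ} (x : Fin k → ℝ) (n : ℕ) :
    Measurable (fun p : ℝ × ℝ => peanoKernel x n p.1 p.2) := by
  simp only [peanoKernel, interpPoly, Lagrange.interpolate_apply, Polynomial.eval_finsetSum,
    Polynomial.eval_mul, Polynomial.eval_C]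
  refine (measurable_taylorKernel n).sub (Finset.measurable_sum _ fun i _ => Measurable.mul ?_ ?_)
  · exact (measurable_taylorKernel n).comp (measurable_const.prodMk measurable_snd)
  · exact (Polynomial.continuous _).measurable.comp measurable_fst

lemma peanoKernel_mul_eq {k : ℕ} (x : Fin k → ℝ) (n : ℕ) (t s c : ℝ) :
    peanoKernel x n t s * c = taylorKernel n t s * c -
      ∑ l : Fin k, taylorKernel n (x l) s * c * (Lagrange.basis Finset.univ x l).eval t := by
  simp only [peanoKernel, interpPoly, Lagrange.interpolate_apply, Polynomial.eval_finsetSum,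
    Polynomial.eval_mul, Polynomial.eval_C, sub_mul, Finset.sum_mul]
  congr 1
  exact Finset.sum_congr rfl fun i _ => by ring

lemma integrable_peanoKernel_mul {k : ℕ} (x : Fin k → ℝ) (n : ℕ) (t : ℝ) {g : ℝ → ℝ}
    (hg : ∀ a b, IntervalIntegrable g volume a b) :
    Integrable (fun s => peanoKernel x n t s * g s) := by
  simp only [peanoKernel_mul_eq]
  exact (integrable_taylorKernel_mul n t hg).sub (integrable_finsetSum _ fun i _ =>
    (integrable_taylorKernel_mul n (x i) hg).mul_const _)

lemma integral_peanoKernel_mul {k : ℕ} (x : Fin k → ℝ) (n : ℕ) (t : ℝ) {g : ℝ → ℝ}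
    (hg : ∀ a b, IntervalIntegrable g volume a b) :
    ∫ s, peanoKernel x n t s * g s = (∫ s, taylorKernel n t s * g s) -
      (interpPoly x (fun u => ∫ s, taylorKernel n u s * g s)).eval t := by
  simp only [peanoKernel_mul_eq]
  rw [integral_sub (integrable_taylorKernel_mul n t hg) (integrable_finsetSum _ fun i _ =>
    (integrable_taylorKernel_mul n (x i) hg).mul_const _),
    integral_finsetSum _ fun i _ => (integrable_taylorKernel_mul n (x i) hg).mul_const _]
  simp only [interpPoly, Lagrange.interpolate_apply, Polynomial.eval_finsetSum,
    Polynomial.eval_mul, Polynomial.eval_C, integral_mul_const]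

lemma intervalIntegrable_iteratedDeriv {n : ℕ} {F : ℝ → ℝ} (hF : F ∈ TestClass (n + 1))
    (a b : ℝ) : IntervalIntegrable (iteratedDeriv (n + 1) F) volume a b := by
  rw [iteratedDeriv_succ]
  exact (absolutelyContinuousOnInterval_iteratedDeriv hF le_rfl a b).intervalIntegrable_deriv

/-- The Peano representation of `F - Q_F`. -/
lemma integral_peanoKernel_mul_iteratedDeriv {k n : ℕ} {x : Fin k → ℝ} (hx : Function.Injective x)
    (hk : k ≤ n + 1) {F : ℝ → ℝ} (hF : F ∈ TestClass (n + 1)) (t : ℝ) :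
    ∫ s, peanoKernel x n t s * iteratedDeriv (n + 1) F s =
      F t - (qPoly x (n + 1) F).eval t := by
  have hg := intervalIntegrable_iteratedDeriv hF
  rw [sub_eval_qPoly hx hk, integral_peanoKernel_mul x n t hg]
  simp only [integral_taylorKernel_mul n _ hg, ← sub_eval_taylorPoly hF _ n le_rfl]

/-- The mass of the kernel is the integrand of `biasConst`, up to the factor `B`; hence `p` has
total mass `β_j`. -/
lemma integral_peanoKernel {k : ℕ} (x : Fin k → ℝ) (n : ℕ) (t : ℝ) :
    ∫ s, peanoKernel x n t s = 1 / ((n + 1).factorial : ℝ) *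
      (t ^ (n + 1) - (interpPoly x (fun u => u ^ (n + 1))).eval t) := by
  have h := integral_peanoKernel_mul x n t (g := fun _ => 1) (fun a b => intervalIntegrable_const)
  have e : ∀ u : ℝ, ∫ s in (0 : ℝ)..u, (u - s) ^ n / (n.factorial : ℝ) =
      1 / ((n + 1).factorial : ℝ) * u ^ (n + 1) := by
    intro u
    rw [intervalIntegral.integral_div, intervalIntegral.integral_comp_sub_left (fun s => s ^ n),
      integral_pow, Nat.factorial_succ]
    have : (n : ℝ) + 1 ≠ 0 := by positivity
    push_cast
    field_simp
    simp
  have hT : ∀ u : ℝ, ∫ s, taylorKernel n u s = 1 / ((n + 1).factorial : ℝ) * u ^ (n + 1) := by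
    intro u
    have h := integral_taylorKernel_mul n u (g := fun _ => 1) fun a b => intervalIntegrable_const
    simpa only [mul_one, e] using h
  simp only [mul_one, hT, interpPoly_const_mul, Polynomial.eval_mul, Polynomial.eval_C] at h
  rw [h]; ring

/-- The bound holds at every point, since `deriv` is `0` where the derivative fails to exist. The
integrals thus make sense under any probability law, even a singular one. -/
lemma exists_abs_iteratedDeriv_le {n : ℕ} {F : ℝ → ℝ} (hF : F ∈ TestClass (n + 1)) :
    ∃ C, ∀ s, ‖iteratedDeriv (n + 1) F s‖ ≤ C := by
  obtain ⟨-, K, hK⟩ := hF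
  exact ⟨K, fun s => by rw [iteratedDeriv_succ]; exact norm_deriv_le_of_lipschitz hK⟩

lemma measurable_iteratedDeriv_succ (n : ℕ) (F : ℝ → ℝ) :
    Measurable (iteratedDeriv (n + 1) F) := by
  rw [iteratedDeriv_succ]; exact measurable_deriv _

lemma iteratedDeriv_iteratedDeriv (i j : ℕ) (f : ℝ → ℝ) :
    iteratedDeriv i (iteratedDeriv j f) = iteratedDeriv (i + j) f := by
  simp only [iteratedDeriv_eq_iterate, Function.iterate_add_apply]

lemma iteratedDeriv_mem_testClass {n j : ℕ} {f : ℝ → ℝ} (hf : f ∈ TestClass (n + 1 + j)) :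
    iteratedDeriv j f ∈ TestClass (n + 1) := by
  rw [show n + 1 + j = n + j + 1 by ring] at hf
  obtain ⟨h, K, hK⟩ := hf
  refine ⟨?_, K, by rwa [iteratedDeriv_iteratedDeriv]⟩
  rw [iteratedDeriv_eq_iterate]
  exact ContDiff.iterate_deriv' n j (by exact_mod_cast h)

lemma integrable_mul_eval {Ω : Type*} [MeasurableSpace Ω] {P : Measure Ω} {X Z : Ω → ℝ} {n : ℕ}
    (h : ∀ l ≤ n, Integrable (fun ω => Z ω * X ω ^ l) P) {p : Polynomial ℝ}
    (hp : p.natDegree ≤ n) : Integrable (fun ω => Z ω * p.eval (X ω)) P := by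
  simp only [Polynomial.eval_eq_sum_range, Finset.mul_sum]
  refine integrable_finsetSum _ fun i hi => ?_
  simp only [mul_left_comm _ (p.coeff i)]
  exact (h i (by have := Finset.mem_range.1 hi; omega)).const_mul _

lemma natDegree_interpPoly_le {k : ℕ} {x : Fin k → ℝ} (hx : Function.Injective x) (g : ℝ → ℝ) :
    (interpPoly x g).natDegree ≤ k := by
  refine Polynomial.natDegree_le_of_degree_le ?_
  have h := Lagrange.degree_interpolate_lt (s := Finset.univ) (fun l => g (x l)) hx.injOn
  rw [Finset.card_fin] at h
  exact h.le

/-! ### The density of a single biased law. -/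

section Density

variable {Ω : Type*} [MeasurableSpace Ω] {P : Measure Ω} {X : Ω → ℝ} {B : ℝ → ℝ}
  {k n : ℕ} {x : Fin k → ℝ}

lemma integrable_mul_peanoKernel (hX : Measurable X) (hB : Measurable B)
    (hsign : HasSignChanges B x) (hk : k ≤ n + 1) (hpar : k ≡ n + 1 [MOD 2])
    (hint : ∀ l ≤ n + 1, Integrable (fun ω => B (X ω) * X ω ^ l) P) :
    Integrable (fun q : Ω × ℝ => B (X q.1) * peanoKernel x n (X q.1) q.2) (P.prod volume) := by
  have hmeas : Measurable (fun q : Ω × ℝ => B (X q.1) * peanoKernel x n (X q.1) q.2) :=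
    ((hB.comp hX).comp measurable_fst).mul
      ((measurable_peanoKernel x n).comp ((hX.comp measurable_fst).prodMk measurable_snd))
  refine (integrable_prod_iff hmeas.aestronglyMeasurable).2 ⟨.of_forall fun ω => ?_, ?_⟩
  · simpa using (integrable_peanoKernel_mul x n (X ω) (g := fun _ => 1)
      (fun a b => intervalIntegrable_const)).const_mul (B (X ω))
  -- By positivity the norm can be dropped, so the inner integral is explicit and only the moment
  -- assumptions are needed.
  · simp only [Real.norm_of_nonneg (mul_peanoKernel_nonneg hsign hk hpar _ _),
      integral_const_mul, integral_peanoKernel]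
    have h := ((hint (n + 1) le_rfl).sub (integrable_mul_eval hint
      ((natDegree_interpPoly_le hsign.1.injective (fun u => u ^ (n + 1))).trans hk))).const_mul
      (1 / ((n + 1).factorial : ℝ))
    refine h.congr (.of_forall fun ω => ?_)
    simp only [Pi.sub_apply]
    ring

lemma integrable_mul_peanoKernel_mul
    (hK : Integrable (fun q : Ω × ℝ => B (X q.1) * peanoKernel x n (X q.1) q.2) (P.prod volume))
    {F : ℝ → ℝ} (hF : F ∈ TestClass (n + 1)) :
    Integrable (fun q : Ω × ℝ => B (X q.1) * peanoKernel x n (X q.1) q.2 *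
      iteratedDeriv (n + 1) F q.2) (P.prod volume) := by
  obtain ⟨C, hC⟩ := exists_abs_iteratedDeriv_le hF
  exact hK.mul_bdd (c := C)
    ((measurable_iteratedDeriv_succ n F).comp measurable_snd).aestronglyMeasurable
    (.of_forall fun q => hC q.2)

lemma integral_mul_peanoKernel_mul (hx : Function.Injective x) (hk : k ≤ n + 1)
    {F : ℝ → ℝ} (hF : F ∈ TestClass (n + 1)) (t : ℝ) :
    ∫ s, B t * peanoKernel x n t s * iteratedDeriv (n + 1) F s =
      B t * (F t - (qPoly x (n + 1) F).eval t) := by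
  simp only [mul_assoc, integral_const_mul, integral_peanoKernel_mul_iteratedDeriv hx hk hF]

/-- The biased distribution exists and is absolutely continuous: its density is the mean of the
Peano kernel of `B(t) (F(t) - Q_F(t))`, divided by the constant. -/
theorem exists_isBiasedLaw [SFinite P] (hX : Measurable X) (hB : Measurable B)
    (hsign : HasSignChanges B x) (hk : k ≤ n + 1) (hpar : k ≡ n + 1 [MOD 2])
    (hint : ∀ l ≤ n + 1, Integrable (fun ω => B (X ω) * X ω ^ l) P) :
    0 ≤ biasConst P X B x (n + 1) ∧
    (∀ F ∈ TestClass (n + 1), Integrable (fun ω => B (X ω) *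
      (F (X ω) - (qPoly x (n + 1) F).eval (X ω))) P) ∧
    ∃ ν : Measure ℝ, ν ≪ volume ∧ IsBiasedLaw P X B x (n + 1) ν := by
  have hx := hsign.1.injective
  have hK := integrable_mul_peanoKernel hX hB hsign hk hpar hint
  have hKmeas : Measurable (fun q : Ω × ℝ => B (X q.1) * peanoKernel x n (X q.1) q.2) :=
    ((hB.comp hX).comp measurable_fst).mul
      ((measurable_peanoKernel x n).comp ((hX.comp measurable_fst).prodMk measurable_snd))
  set p : ℝ → ℝ := fun s => ∫ ω, B (X ω) * peanoKernel x n (X ω) s ∂P with hp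
  set β := biasConst P X B x (n + 1) with hβ
  have hp0 : ∀ s, 0 ≤ p s := fun s =>
    integral_nonneg fun ω => mul_peanoKernel_nonneg hsign hk hpar _ _
  have hpm : Measurable p := (hKmeas.stronglyMeasurable.integral_prod_left' (μ := P)).measurable
  have hpi : Integrable p := hK.integral_prod_right
  have hpβ : ∫ s, p s = β := by
    rw [hp, integral_integral_swap (f := fun s ω => B (X ω) * peanoKernel x n (X ω) s) hK.swap]
    simp only [integral_const_mul, integral_peanoKernel, hβ, biasConst, mul_left_comm (B _)]
  have hid : ∀ F ∈ TestClass (n + 1),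
      ∫ ω, B (X ω) * (F (X ω) - (qPoly x (n + 1) F).eval (X ω)) ∂P =
        ∫ s, p s * iteratedDeriv (n + 1) F s := by
    intro F hF
    have h := integral_integral_swap
      (f := fun ω s => B (X ω) * peanoKernel x n (X ω) s * iteratedDeriv (n + 1) F s)
      (integrable_mul_peanoKernel_mul hK hF)
    simp only [integral_mul_peanoKernel_mul hx hk hF, integral_mul_const] at h
    exact h
  have hβ0 : 0 ≤ β := hpβ ▸ integral_nonneg hp0
  refine ⟨hβ0, fun F hF => ?_, ?_⟩
  · have h := (integrable_mul_peanoKernel_mul hK hF).integral_prod_left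
    simp only [integral_mul_peanoKernel_mul hx hk hF] at h
    exact h
  rcases hβ0.eq_or_lt with h0 | hpos
  -- If `β = 0`, then `p = 0` almost everywhere and both sides vanish. Any absolutely continuous
  -- probability law serves; the uniform law on `[0, 1]` is taken.
  · refine ⟨volume.restrict (Set.Icc 0 1), Measure.absolutelyContinuous_of_le
      Measure.restrict_le_self, ⟨by simp⟩, fun F hF => ?_⟩
    have hp_ae : p =ᵐ[volume] 0 :=
      (integral_eq_zero_iff_of_nonneg hp0 hpi).1 (hpβ.trans h0.symm)
    rw [hid F hF, ← hβ, ← h0, zero_mul]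
    refine integral_eq_zero_of_ae (hp_ae.mono fun s hs => ?_)
    simp [hs]
  · refine ⟨volume.withDensity fun s => ENNReal.ofReal (p s / β),
      withDensity_absolutelyContinuous _ _, ⟨?_⟩, fun F hF => ?_⟩
    · rw [withDensity_apply _ MeasurableSet.univ, Measure.restrict_univ,
        ← ofReal_integral_eq_lintegral_ofReal (hpi.div_const β)
          (.of_forall fun s => div_nonneg (hp0 s) hβ0), integral_div, hpβ, div_self hpos.ne',
        ENNReal.ofReal_one]
    · rw [hid F hF, integral_withDensity_eq_integral_toReal_smul
        (hpm.div_const β).ennreal_ofReal (.of_forall fun s => ENNReal.ofReal_lt_top),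
        ← integral_const_mul]
      refine integral_congr_ae (.of_forall fun s => ?_)
      simp only [ENNReal.toReal_ofReal (div_nonneg (hp0 s) hβ0), smul_eq_mul, ← hβ]
      field_simp

end Density

/-! ### Test functions for uniqueness. -/

/-- Every bounded continuous function is the derivative of order `n + 1` of a `C^{n+1}` function
in the test class. -/
lemma exists_iteratedDeriv_eq (g : BoundedContinuousFunction ℝ ℝ) (n : ℕ) :
    ∃ f ∈ TestClass (n + 1), ContDiff ℝ (n + 1 : ℕ) f ∧ iteratedDeriv (n + 1) f = g := by
  have prim : ∀ h : ℝ → ℝ, Continuous h →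
      ∀ t, HasDerivAt (fun t => ∫ s in (0 : ℝ)..t, h s) (h t) t := fun h hh t =>
    intervalIntegral.integral_hasDerivAt_right (hh.intervalIntegrable _ _)
      hh.stronglyMeasurable.stronglyMeasurableAtFilter hh.continuousAt
  -- Iterated primitives from `0`; the Lipschitz constant below is the sup norm of `g`.
  have main : ∀ m : ℕ, ∃ f : ℝ → ℝ, ContDiff ℝ m f ∧ iteratedDeriv m f = g := by
    intro m
    induction m with
    | zero => exact ⟨g, contDiff_zero.2 g.continuous, iteratedDeriv_zero⟩
    | succ m ih =>
      obtain ⟨f, hf, hfg⟩ := ih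
      have hd := prim f hf.continuous
      have hderiv : deriv (fun t => ∫ s in (0 : ℝ)..t, f s) = f := funext fun t => (hd t).deriv
      refine ⟨fun t => ∫ s in (0 : ℝ)..t, f s, ?_, ?_⟩
      · push_cast
        rw [contDiff_succ_iff_deriv]
        exact ⟨fun t => (hd t).differentiableAt, by simp, by rwa [hderiv]⟩
      · rw [iteratedDeriv_succ', hderiv, hfg]
  obtain ⟨f, hf, hfg⟩ := main (n + 1)
  refine ⟨f, ⟨hf.of_le (by norm_cast; omega), ‖g‖₊, ?_⟩, hf, hfg⟩
  refine lipschitzWith_of_nnnorm_deriv_le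
    (hf.differentiable_iteratedDeriv n (by norm_cast; omega)) fun t => ?_
  rw [← iteratedDeriv_succ, hfg]
  exact g.nnnorm_coe_le_nnnorm t

end DistTransform

end

/-! ### Mixing the biased laws. -/

/-- For `f` in the test class of order `m`, the derivative of order `m` exists Lebesgue-almost
everywhere. Uniqueness is asserted among all probability laws, and only the `f` that are moreover
`m` times continuously differentiable are needed to single out the law. -/
theorem mainTheorem4 {Ω : Type*} [MeasurableSpace Ω] (P : Measure Ω) [IsProbabilityMeasure P]
    (X : Ω → ℝ) (hX : Measurable X) (m : ℕ)
    (B : Fin m → ℝ → ℝ) (hB : ∀ j, Measurable (B j))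
    (k : Fin m → ℕ) (hk : ∀ j, k j ≤ m - (j : ℕ)) (hpar : ∀ j, k j ≡ m - (j : ℕ) [MOD 2])
    (x : (j : Fin m) → Fin (k j) → ℝ)
    (hsign : ∀ j, DistTransform.HasSignChanges (B j) (x j))
    (hint : ∀ j : Fin m, ∀ l : ℕ, l ≤ m - (j : ℕ) →
      Integrable (fun ω => B j (X ω) * X ω ^ l) P)
    (hpos : ∃ j : Fin m, 0 < DistTransform.biasConst P X (B j) (x j) (m - (j : ℕ))) :
    (∀ j : Fin m, 0 ≤ DistTransform.biasConst P X (B j) (x j) (m - (j : ℕ))) ∧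
    0 < DistTransform.totalConst P X B x ∧
    (∀ f ∈ DistTransform.TestClass m, ∀ j : Fin m,
      Integrable (fun ω => B j (X ω) * (iteratedDeriv (j : ℕ) f (X ω) -
        (DistTransform.qPoly (x j) (m - (j : ℕ)) (iteratedDeriv (j : ℕ) f)).eval (X ω))) P) ∧
    ∃ ν : Measure ℝ, IsProbabilityMeasure ν ∧ ν ≪ volume ∧
      (∀ f ∈ DistTransform.TestClass m,
        Integrable (iteratedDeriv m f) ν ∧ DistTransform.HigherOrderIdentity P X B x ν f) ∧
      (∀ ν' : Measure ℝ, IsProbabilityMeasure ν' →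
        (∀ f ∈ DistTransform.TestClass m, ContDiff ℝ m f →
          DistTransform.HigherOrderIdentity P X B x ν' f) → ν' = ν) ∧
      (∃ Y : Fin m → Measure ℝ, (∀ j, IsProbabilityMeasure (Y j)) ∧
        (∀ j : Fin m, 0 < DistTransform.biasConst P X (B j) (x j) (m - (j : ℕ)) →
          DistTransform.IsBiasedLaw P X (B j) (x j) (m - (j : ℕ)) (Y j)) ∧
        ν = ∑ j : Fin m,
          ENNReal.ofReal (DistTransform.biasConst P X (B j) (x j) (m - (j : ℕ)) /
            DistTransform.totalConst P X B x) • Y j) := by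
  have hdata : ∀ j : Fin m, _ := fun j => by
    have e : m - (j : ℕ) = (m - (j : ℕ) - 1) + 1 := by omega
    exact DistTransform.exists_isBiasedLaw (P := P) (n := m - (j : ℕ) - 1) hX (hB j) (hsign j)
      (e ▸ hk j) (e ▸ hpar j) (fun l hl => hint j l (by omega))
  have e : ∀ j : Fin m, (m - (j : ℕ) - 1) + 1 = m - (j : ℕ) := fun j => by omega
  simp only [e] at hdata
  have hmem : ∀ f ∈ DistTransform.TestClass m, ∀ j : Fin m,
      iteratedDeriv (j : ℕ) f ∈ DistTransform.TestClass (m - (j : ℕ)) := fun f hf j => by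
    rw [← e j]
    refine DistTransform.iteratedDeriv_mem_testClass ?_
    rwa [e j, Nat.sub_add_cancel j.2.le]
  have hderiv : ∀ f : ℝ → ℝ, ∀ j : Fin m,
      iteratedDeriv (m - (j : ℕ)) (iteratedDeriv (j : ℕ) f) = iteratedDeriv m f := fun f j => by
    rw [DistTransform.iteratedDeriv_iteratedDeriv, Nat.sub_add_cancel j.2.le]
  have hβ0 := fun j => (hdata j).1
  choose Y hYac hY using fun j => (hdata j).2.2
  obtain ⟨j₀, hj₀⟩ := hpos
  have hβ : 0 < DistTransform.totalConst P X B x :=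
    Finset.sum_pos' (fun j _ => hβ0 j) ⟨j₀, Finset.mem_univ _, hj₀⟩
  set β := DistTransform.totalConst P X B x with hβdef
  set b : Fin m → ℝ := fun j => DistTransform.biasConst P X (B j) (x j) (m - (j : ℕ)) with hb
  have hsum : ∑ j, b j / β = 1 := by
    rw [← Finset.sum_div]; exact div_self hβ.ne'
  have hw0 : ∀ j, 0 ≤ b j / β := fun j => div_nonneg (hβ0 j) hβ.le
  set ν : Measure ℝ := ∑ j, ENNReal.ofReal (b j / β) • Y j with hν
  have hYprob : ∀ j, IsProbabilityMeasure (Y j) := fun j => (hY j).1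
  have hνprob : IsProbabilityMeasure ν := ⟨by
    simp only [hν, Measure.coe_finsetSum, Finset.sum_apply, Measure.smul_apply, measure_univ,
      smul_eq_mul, mul_one]
    rw [← ENNReal.ofReal_sum_of_nonneg fun j _ => hw0 j, hsum, ENNReal.ofReal_one]⟩
  -- The index `j₀` forces `m ≥ 1`.
  obtain ⟨n, rfl⟩ : ∃ n, m = n + 1 := ⟨m - 1, by have := j₀.2; omega⟩
  have hbdd : ∀ f ∈ DistTransform.TestClass (n + 1), ∀ μ : Measure ℝ, IsProbabilityMeasure μ →
      Integrable (iteratedDeriv (n + 1) f) μ := fun f hf μ _ => by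
    obtain ⟨C, hC⟩ := DistTransform.exists_abs_iteratedDeriv_le hf
    exact .of_bound (DistTransform.measurable_iteratedDeriv_succ n f).aestronglyMeasurable C
      (.of_forall hC)
  have hidentity : ∀ f ∈ DistTransform.TestClass (n + 1),
      DistTransform.HigherOrderIdentity P X B x ν f := fun f hf => by
    have h : ∫ y, iteratedDeriv (n + 1) f y ∂ν =
        ∑ j, b j / β * ∫ y, iteratedDeriv (n + 1) f y ∂(Y j) := by
      rw [hν, integral_finsetSum_measure fun j _ =>
        (hbdd f hf (Y j) (hYprob j)).smul_measure ENNReal.ofReal_ne_top]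
      refine Finset.sum_congr rfl fun j _ => ?_
      rw [integral_smul_measure, ENNReal.toReal_ofReal (hw0 j), smul_eq_mul]
    rw [DistTransform.HigherOrderIdentity, h, Finset.mul_sum]
    refine Finset.sum_congr rfl fun j _ => ?_
    rw [(hY j).2 _ (hmem f hf j), hderiv, ← hβdef, ← mul_assoc,
      mul_div_cancel₀ _ hβ.ne']
  refine ⟨hβ0, hβ, fun f hf j => (hdata j).2.1 _ (hmem f hf j), ν, hνprob, ?_,
    fun f hf => ⟨hbdd f hf ν hνprob, hidentity f hf⟩, ?_, Y, hYprob, fun j _ => hY j, rfl⟩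
  · intro s hs
    simp [hν, Measure.coe_finsetSum, fun j => hYac j hs]
  · intro ν' _ hν'
    -- Finite measures are determined by bounded continuous `g`. Taking `f` with `f^{(m)} = g`, the
    -- two identities share their left side, and `β ≠ 0` cancels.
    refine ext_of_forall_integral_eq_of_IsFiniteMeasure fun g => ?_
    obtain ⟨f, hf, hfc, hfg⟩ := DistTransform.exists_iteratedDeriv_eq g n
    have h := (hν' f hf hfc).symm.trans (hidentity f hf)
    rw [hfg] at h
    exact mul_left_cancel₀ hβ.ne' h
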